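/- Let $\beta\ge 0$, $T>0$, $P>0$. Let $p:\mathbb R\to\mathbb R$ be a continuous pulse with $|p(t)|\le C(1+|t|)^{-r}$ for some $C$ and some $r>1$. Let $g=p\star p^*(-\,\cdot)$ be the matched filter response and $G(f)=\int g(t)e^{-2\pi i ft}\,dt$, and assume that $G(f)\neq 0$ exactly for $|f|<\frac{1+\beta}{2T}$ (for instance, a root-raised-cosine pulse with roll-off factor $\beta\in(0,1]$ and $r=2$). Fix an acceleration factor $0<\delta<\frac1{1+\beta}$ and a threshold $\gamma\ge 0$. For $N=2M+1$ let $Z$ be the number of $i\in\{-M,\dots,M\}$ with $G\big(\frac{i}{N\delta T}\big)\ne0$, let $$\tilde\lambda_i=\frac{T}{(1+\beta)\,G\big(\frac{i}{N\delta T}\big)}\ \text{ for } |i|<\tfrac Z2,\qquad \tilde\lambda_i=0\ \text{ for }\tfrac Z2\le|i|\le M,$$ and let $\Sigma_N=P\delta T\,D\,\mathrm{diag}(\tilde\lambda_{-M},\dots,\tilde\lambda_M)\,D^\dagger$ with the DFT matrix $D_{m,n}=N^{-1/2}e^{-2\pi i mn/N}$, $-M\le m,n\le M$. This is the optimal symbol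 covariance of faster-than-Nyquist signaling in the time domain for fixed transmit power $P$ (fixed transmit SNR) on the given antenna. The symbols are complex Gaussian: $a[m]=a_r[m]+i\,a_i[m]$, $-M\le m\le M$, where the vectors $a_r$ and $a_i$ are independent with the same law $\mathcal N(0,\tfrac12\Sigma_N)$. For a signal $x(t)$ formed from these symbols, let $$\bar{\mathcal C}(\gamma)=\frac1{\delta T}\int_0^{\delta T}\Pr\big[|x(t)|^2\ge\gamma\big]\,dt$$ be its period-averaged complementary cumulative distribution function (CCDF). Here the power $|x(t)|^2$ is not divided by $P$; the average CCDF of the ratio $|x(t)|^2/P$ at $\gamma'$ is $\bar{\mathcal C}(\gamma' P)$. 1. (Cyclostationary signal.) Let $x(t)=\sum_{m\in\mathbb Z}a[m]\,p(t-m\delta T)$, where the block of $N$ symbols is extended $N$-periodically to all $m\in\mathbb Z$, and let $\bar{\mathcal C}^{\mathrm{cs}}_N(\gamma)$ be its average CCDF. Then $$\lim_{N\to\infty}\bar{\mathcal C}^{\mathrm{cs}}_N(\gamma)=\exp\Big(-\frac{\gamma}{P}\Big).$$ 2. (Finite block.) Let $x(t)=\sum_{m=-M}^{M}a[m]\,p(t-m\delta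 T)$ and let $\bar{\mathcal C}_N(\gamma)$ be its average CCDF. Then $\bar{\mathcal C}_N(\gamma)\to\exp(-\gamma/P)$ as $N\to\infty$ along every sequence of block lengths for which $N^{-(2r-1)}\sum_{i=-M}^{M}\tilde\lambda_i\to0$. In particular these limits do not depend on $\delta\in\big(0,\frac1{1+\beta}\big)$. -/

import Mathlib

open Filter Topology MeasureTheory ProbabilityTheory

noncomputable section

namespace FTN

/-- Indices `-M, …, M` of the `N = 2 * M + 1` symbols of a block (and of the `N` DFT bins). -/
abbrev Idx (M : ℕ) : Type := ↥(Finset.Icc (-(M : ℤ)) (M : ℤ))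

/-- The block length `N = 2 * M + 1`, as a real number. -/
def blockLen (M : ℕ) : ℝ := 2 * (M : ℝ) + 1

/-- Matched filter response `g = p ⋆ p^*(-·)`. -/
def matchedFilter (p : ℝ → ℝ) : ℝ → ℂ :=
  convolution (fun t => (p t : ℂ)) (fun t => star (p (-t) : ℂ))
    (ContinuousLinearMap.mul ℂ ℂ) volume

/-- Fourier transform `G(f) = ∫ g(t) e^{-2π i f t} dt` of the matched filter response
(it is real valued, being equal to `|p̂(f)|²`). -/
def spectrumG (p : ℝ → ℝ) (f : ℝ) : ℝ :=
  (FourierTransform.fourier (matchedFilter p) f).re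

/-- Number `Z` of the frequencies `i / (N δ T)`, `-M ≤ i ≤ M`, at which `G` does not vanish. -/
def numNonzero (p : ℝ → ℝ) (T δ : ℝ) (M : ℕ) : ℕ :=
  Nat.card {i : Idx M // spectrumG p (((i : ℤ) : ℝ) / (blockLen M * δ * T)) ≠ 0}

/-- The `i`-th sample of the optimal input spectrum:
`T / (G(i/(NδT)) (1+β))` for `|i| < Z/2`, and `0` for `Z/2 ≤ |i| ≤ M`. -/
def optEigenvalue (p : ℝ → ℝ) (β T δ : ℝ) (M : ℕ) (i : Idx M) : ℝ :=
  if |((i : ℤ) : ℝ)| < (numNonzero p T δ M : ℝ) / 2 then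
    T / (spectrumG p (((i : ℤ) : ℝ) / (blockLen M * δ * T)) * (1 + β))
  else 0

/-- The DFT matrix with entries `N^{-1/2} e^{-2π i m n / N}`. -/
def dftMatrix (M : ℕ) : Matrix (Idx M) (Idx M) ℂ := fun m n =>
  (1 / Real.sqrt (blockLen M) : ℂ) *
    Complex.exp (-2 * Real.pi * Complex.I * ((m : ℤ) : ℂ) * ((n : ℤ) : ℂ) / (blockLen M : ℂ))

/-- The optimal covariance matrix `Σ = P δ T D Λ⁻¹ D†` of the symbols of a block, for
transmit power `P`. Its entries are real, because the eigenvalues are even in the index. -/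
def optCovariance (p : ℝ → ℝ) (β T δ P : ℝ) (M : ℕ) : Matrix (Idx M) (Idx M) ℂ :=
  ((P * δ * T : ℝ) : ℂ) •
    (dftMatrix M * Matrix.diagonal (fun i => (optEigenvalue p β T δ M i : ℂ)) *
      (dftMatrix M).conjTranspose)

/-- Joint law of `(a_r, a_i)`, the real and imaginary parts of the vector of symbols:
independent centred Gaussian vectors, each with covariance matrix `Σ / 2`. -/
def symbolLaw (p : ℝ → ℝ) (β T δ P : ℝ) (M : ℕ) :
    Measure (EuclideanSpace ℝ (Idx M) × EuclideanSpace ℝ (Idx M)) :=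
  (multivariateGaussian 0 ((1 / 2 : ℝ) • (optCovariance p β T δ P M).map Complex.re)).prod
    (multivariateGaussian 0 ((1 / 2 : ℝ) • (optCovariance p β T δ P M).map Complex.re))

/-- The signal `x(t) = ∑_{m=-M}^{M} (a_r[m] + i a_i[m]) q(t - m δ T)` sent with the pulse `q`. -/
def signal (q : ℝ → ℝ) (T δ : ℝ) (M : ℕ)
    (a : EuclideanSpace ℝ (Idx M) × EuclideanSpace ℝ (Idx M)) (t : ℝ) : ℂ :=
  ∑ m : Idx M, ((a.1 m : ℂ) + Complex.I * (a.2 m : ℂ)) * (q (t - ((m : ℤ) : ℝ) * δ * T) : ℂ)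

/-- The CCDF `𝒞(γ; t) = Pr[|x(t)|² ≥ γ]` of the instantaneous power, for a law `μ` of the
symbols. -/
def ccdf {M : ℕ} (μ : Measure (EuclideanSpace ℝ (Idx M) × EuclideanSpace ℝ (Idx M)))
    (q : ℝ → ℝ) (T δ γ t : ℝ) : ℝ :=
  μ.real {a | γ ≤ ‖signal q T δ M a t‖ ^ 2}

/-- The CCDF averaged over one symbol period, `(δT)⁻¹ ∫_0^{δT} 𝒞(γ; t) dt`. -/
def avgCCDF {M : ℕ} (μ : Measure (EuclideanSpace ℝ (Idx M) × EuclideanSpace ℝ (Idx M)))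
    (q : ℝ → ℝ) (T δ γ : ℝ) : ℝ :=
  1 / (δ * T) * ∫ t in (0 : ℝ)..(δ * T), ccdf μ q T δ γ t

/-- The pulse made periodic with period `L`. With `L = N δ T`, the signal formed with it is
`∑_{m ∈ ℤ} a[m mod N] p(t - m δ T)`: the block of `N` symbols is repeated for ever, and the
signal is exactly cyclostationary with period `δ T`. -/
def periodize (p : ℝ → ℝ) (L : ℝ) (t : ℝ) : ℝ := ∑' l : ℤ, p (t - (l : ℝ) * L)

end FTN

end

/-!
At a fixed instant `t` the signal is a linear functional of the Gaussian symbols, so it is a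
circular complex Gaussian variable and its power is exponentially distributed: the CCDF is
`exp (-γ / v(t))`, where `v(t) = E |x(t)|²` (`FTN.ccdf_symbolLaw`). The covariance is diagonal in the
Fourier basis, so with `τ = δ T`
  `v(t) = (P τ / N) ∑ i, λᵢ |Bᵢ(t)|²`,
where `Bᵢ(t)` is the transform at the frequency `i / N` of the samples `m ↦ q(t - m τ)` of the
pulse over the block (`FTN.meanPower`).

If the sum over the block is replaced by the sum over all `m ∈ ℤ`, Poisson summation evaluates it:
`δ < 1 / (1 + β)` means that the sampling rate `1 / τ` exceeds the bandwidth of the pulse, so a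
single spectral replica survives and the squared modulus is `G(i / (N τ)) / τ²`, whatever `t` is
(`FTN.norm_lineTransform_sq`). The eigenvalues invert `G`, so all nonvanishing frequencies
contribute equally and the mean power is `P Z / (N δ (1 + β))` (`FTN.meanPower_line`). It tends to
`P`, since the `Z` indices are those with `|i| < N δ (1 + β) / 2` (`FTN.tendsto_numNonzero_div`).

For the cyclostationary signal this replacement is exact (`FTN.blockTransform_periodize`). For a
finite block its error is the sum of the pulse over `|m| > M`, which is `O(N ^ (1 - r))` uniformly
over one period (`FTN.norm_lineTransform_sub_blockTransform_le`). Weighted by `λᵢ / N`, its energy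
is `O(N ^ (-(2 r - 1)) ∑ i, λᵢ)`, which tends to `0` by assumption, and the triangle inequality in
`ℓ²` transfers the limit from one mean power to the other. The average over the period is then
passed to the limit by dominated convergence (`FTN.tendsto_avgCCDF`).
-/

noncomputable section

namespace FTN

/-! ### Squared modulus of a complex Gaussian variable -/

lemma integral_Ioi_mul_exp_neg_sq {v : ℝ} (hv : 0 < v) {γ : ℝ} (hγ : 0 ≤ γ) :
    ∫ ρ in Set.Ioi (Real.sqrt γ), ρ * Real.exp (-ρ ^ 2 / (2 * v)) =
      v * Real.exp (-γ / (2 * v)) := by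
  have hder : ∀ x ∈ Set.Ici (Real.sqrt γ),
      HasDerivAt (fun ρ : ℝ => -(v * Real.exp (-ρ ^ 2 / (2 * v))))
        (x * Real.exp (-x ^ 2 / (2 * v))) x := by
    intro x _
    have h1 : HasDerivAt (fun ρ : ℝ => -ρ ^ 2 / (2 * v)) (-(2 * x) / (2 * v)) x := by
      have := ((hasDerivAt_pow 2 x).neg).div_const (2 * v)
      simpa using this
    have h2 := (h1.exp.const_mul v).neg
    refine h2.congr_deriv ?_
    field_simp
  have hlim : Tendsto (fun ρ : ℝ => -(v * Real.exp (-ρ ^ 2 / (2 * v)))) atTop (𝓝 0) := by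
    have h1 : Tendsto (fun ρ : ℝ => -ρ ^ 2 / (2 * v)) atTop atBot := by
      have : Tendsto (fun ρ : ℝ => ρ ^ 2 / (2 * v)) atTop atTop :=
        (tendsto_pow_atTop two_ne_zero).atTop_div_const (by positivity)
      simpa only [neg_div] using tendsto_neg_atBot_iff.2 this
    simpa using ((Real.tendsto_exp_atBot.comp h1).const_mul v).neg
  have hpos : ∀ x ∈ Set.Ioi (Real.sqrt γ), 0 ≤ x * Real.exp (-x ^ 2 / (2 * v)) := by
    intro x hx
    have : 0 ≤ x := (Real.sqrt_nonneg γ).trans (le_of_lt hx)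
    positivity
  rw [integral_Ioi_of_hasDerivAt_of_nonneg' hder hpos hlim]
  simp [Real.sq_sqrt hγ]

/-- The squared modulus of a centred isotropic Gaussian vector in the plane is exponentially
distributed: the polar coordinate change makes the radial density an exact derivative. -/
lemma gaussianReal_prod_real_le_sq_add_sq {v : NNReal} (hv : v ≠ 0) {γ : ℝ} (hγ : 0 ≤ γ) :
    ((gaussianReal 0 v).prod (gaussianReal 0 v)).real {x | γ ≤ x.1 ^ 2 + x.2 ^ 2} =
      Real.exp (-γ / (2 * v)) := by
  have hv' : (0 : ℝ) < v := by positivity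
  have hs : MeasurableSet {x : ℝ × ℝ | γ ≤ x.1 ^ 2 + x.2 ^ 2} :=
    measurableSet_le measurable_const (by fun_prop)
  rw [Measure.real, gaussianReal_of_var_ne_zero _ hv,
    prod_withDensity (measurable_gaussianPDF 0 v) (measurable_gaussianPDF 0 v),
    withDensity_apply _ hs, ← lintegral_indicator hs]
  have hint : ∀ x : ℝ × ℝ, Set.indicator {x : ℝ × ℝ | γ ≤ x.1 ^ 2 + x.2 ^ 2}
      (fun z : ℝ × ℝ => gaussianPDF 0 v z.1 * gaussianPDF 0 v z.2) x =
      ENNReal.ofReal (Set.indicator {x : ℝ × ℝ | γ ≤ x.1 ^ 2 + x.2 ^ 2}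
        (fun z : ℝ × ℝ => gaussianPDFReal 0 v z.1 * gaussianPDFReal 0 v z.2) x) := by
    intro x
    by_cases hx : x ∈ {x : ℝ × ℝ | γ ≤ x.1 ^ 2 + x.2 ^ 2}
    · simp only [Set.indicator_of_mem hx, gaussianPDF]
      rw [ENNReal.ofReal_mul (gaussianPDFReal_nonneg _ _ _)]
    · simp [Set.indicator_of_notMem hx]
  simp_rw [hint]
  rw [← Measure.volume_eq_prod, ← integral_eq_lintegral_of_nonneg_ae]
  rotate_left
  · refine ae_of_all _ fun x => Set.indicator_nonneg (fun z _ => ?_) x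
    exact mul_nonneg (gaussianPDFReal_nonneg _ _ _) (gaussianPDFReal_nonneg _ _ _)
  · refine (Measurable.indicator ?_ hs).aestronglyMeasurable
    exact ((measurable_gaussianPDFReal 0 v).comp measurable_fst).mul
      ((measurable_gaussianPDFReal 0 v).comp measurable_snd)
  rw [← integral_comp_polarCoord_symm]
  have hpol : ∀ z ∈ polarCoord.target,
      z.1 • Set.indicator {x : ℝ × ℝ | γ ≤ x.1 ^ 2 + x.2 ^ 2}
        (fun z : ℝ × ℝ => gaussianPDFReal 0 v z.1 * gaussianPDFReal 0 v z.2)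
        (polarCoord.symm z) =
      (2 * Real.pi * v)⁻¹ * (Set.indicator (Set.Ici (Real.sqrt γ))
        (fun ρ => ρ * Real.exp (-ρ ^ 2 / (2 * v))) z.1 * 1) := by
    rintro ⟨ρ, θ⟩ hz
    have hρ : 0 < ρ := by
      have := hz.1
      simpa using this
    have hsq : (ρ * Real.cos θ) ^ 2 + (ρ * Real.sin θ) ^ 2 = ρ ^ 2 := by
      rw [mul_pow, mul_pow, ← mul_add, Real.cos_sq_add_sin_sq, mul_one]
    by_cases hle : Real.sqrt γ ≤ ρ
    · have h2 : polarCoord.symm (ρ, θ) ∈ {x : ℝ × ℝ | γ ≤ x.1 ^ 2 + x.2 ^ 2} := by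
        simp only [polarCoord_symm_apply, Set.mem_ofPred_eq, hsq]
        exact (Real.sqrt_le_left hρ.le).1 hle
      rw [Set.indicator_of_mem h2, Set.indicator_of_mem (show (ρ, θ).1 ∈ Set.Ici _ from hle)]
      simp only [polarCoord_symm_apply, gaussianPDFReal, sub_zero, smul_eq_mul, mul_one]
      have h3 : Real.exp (-(ρ * Real.cos θ) ^ 2 / (2 * v)) *
          Real.exp (-(ρ * Real.sin θ) ^ 2 / (2 * v)) = Real.exp (-ρ ^ 2 / (2 * v)) := by
        rw [← Real.exp_add, ← hsq]
        congr 1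
        ring
      have h4 : (Real.sqrt (2 * Real.pi * v))⁻¹ * (Real.sqrt (2 * Real.pi * v))⁻¹ =
          (2 * Real.pi * v)⁻¹ := by
        rw [← mul_inv, Real.mul_self_sqrt (by positivity)]
      rw [← h3, ← h4]
      ring
    · have h2 : polarCoord.symm (ρ, θ) ∉ {x : ℝ × ℝ | γ ≤ x.1 ^ 2 + x.2 ^ 2} := by
        simp only [polarCoord_symm_apply, Set.mem_ofPred_eq, hsq]
        exact fun h => hle ((Real.sqrt_le_left hρ.le).2 h)
      rw [Set.indicator_of_notMem h2, Set.indicator_of_notMem (show (ρ, θ).1 ∉ Set.Ici _ from hle)]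
      simp
  rw [setIntegral_congr_fun polarCoord.open_target.measurableSet hpol, integral_const_mul,
    polarCoord_target, Measure.volume_eq_prod,
    setIntegral_prod_mul (fun ρ => Set.indicator (Set.Ici (Real.sqrt γ))
        (fun ρ => ρ * Real.exp (-ρ ^ 2 / (2 * v))) ρ) (fun _ => (1 : ℝ)),
    setIntegral_indicator measurableSet_Ici]
  have hset : (Set.Ioi 0 ∩ Set.Ici (Real.sqrt γ) : Set ℝ) =ᵐ[volume] Set.Ioi (Real.sqrt γ) := by
    refine (ae_eq_refl (Set.Ioi (0 : ℝ))).inter Ioi_ae_eq_Ici.symm |>.trans ?_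
    rw [Set.Ioi_inter_Ioi, sup_eq_right.2 (Real.sqrt_nonneg γ)]
    rfl
  rw [setIntegral_congr_set hset, integral_Ioi_mul_exp_neg_sq hv' hγ]
  simp only [integral_const, MeasurableSet.univ, measureReal_restrict_apply, Set.univ_inter,
    Real.volume_real_Ioo, smul_eq_mul, mul_one]
  have hpi := Real.pi_pos
  rw [max_eq_left (by linarith)]
  field_simp
  ring

/-- A linear functional of a centred Gaussian vector is a centred Gaussian variable. -/
lemma multivariateGaussian_map_inner {ι : Type*} [Fintype ι] [DecidableEq ι]
    {S : Matrix ι ι ℝ} (hS : S.PosSemidef) (w : EuclideanSpace ℝ ι) :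
    (multivariateGaussian 0 S).map (fun x => inner ℝ w x) =
      gaussianReal 0 (w ⬝ᵥ S.mulVec w).toNNReal := by
  have h := IsGaussian.map_eq_gaussianReal (μ := multivariateGaussian 0 S) (innerSL ℝ w)
  have e : (⇑(innerSL ℝ w) : EuclideanSpace ℝ ι → ℝ) = fun x => inner ℝ w x := by
    ext x; simp
  have hmean : ∫ x, innerSL ℝ w x ∂(multivariateGaussian 0 S) = 0 := by
    rw [ContinuousLinearMap.integral_comp_comm _ IsGaussian.integrable_fun_id]
    simp
  rw [hmean, e] at h
  rw [h]
  congr 2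
  rw [← covariance_self (by fun_prop), ← covarianceBilin_apply_eq_cov IsGaussian.memLp_two_id,
    covarianceBilin_multivariateGaussian hS]

/-- The signal at one instant is a circular complex Gaussian variable; its real and imaginary
parts have variance `wᵀ S w`, where `w` samples the shifted pulses. -/
lemma ccdf_prod_multivariateGaussian {M : ℕ} {S : Matrix (Idx M) (Idx M) ℝ}
    (hS : S.PosSemidef) (q : ℝ → ℝ) (T δ t : ℝ) {γ : ℝ} (hγ : 0 ≤ γ) {w : Idx M → ℝ}
    (hw : w = fun m : Idx M => q (t - ((m : ℤ) : ℝ) * δ * T)) (hpos : 0 < w ⬝ᵥ S.mulVec w) :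
    ccdf ((multivariateGaussian 0 S).prod (multivariateGaussian 0 S)) q T δ γ t =
      Real.exp (-γ / (2 * (w ⬝ᵥ S.mulVec w))) := by
  set W : EuclideanSpace ℝ (Idx M) := WithLp.toLp 2 w with hW
  have hmap := multivariateGaussian_map_inner hS W
  have hm : Measurable fun x : EuclideanSpace ℝ (Idx M) => inner ℝ W x := by fun_prop
  have hv : (W ⬝ᵥ S.mulVec W).toNNReal ≠ 0 := by
    simpa [hW] using hpos
  have h := gaussianReal_prod_real_le_sq_add_sq hv hγ
  rw [Real.coe_toNNReal _ hpos.le, ← hmap,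
    Measure.map_prod_map _ _ hm hm] at h
  have hs : MeasurableSet {x : ℝ × ℝ | γ ≤ x.1 ^ 2 + x.2 ^ 2} :=
    measurableSet_le measurable_const (by fun_prop)
  rw [map_measureReal_apply (by fun_prop) hs] at h
  rw [ccdf, ← h]
  congr 1
  ext a
  have hsig : signal q T δ M a t =
      ((inner ℝ W a.1 : ℝ) : ℂ) + ((inner ℝ W a.2 : ℝ) : ℂ) * Complex.I := by
    simp only [signal, PiLp.inner_apply, hW, hw, Complex.ofReal_sum, Finset.sum_mul,
      ← Finset.sum_add_distrib]
    refine Finset.sum_congr rfl fun m _ => ?_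
    simp only [RCLike.inner_apply, conj_trivial, Complex.ofReal_mul]
    ring
  simp only [Set.mem_ofPred_eq, Set.mem_preimage, Prod.map, hsig]
  rw [← Complex.normSq_eq_norm_sq, Complex.normSq_add_mul_I]

/-! ### Mean power in the Fourier basis -/

section Covariance

open Matrix
open scoped ComplexOrder

lemma dotProduct_map_re_mulVec {ι : Type*} [Fintype ι] (A : Matrix ι ι ℂ) (w : ι → ℝ) :
    w ⬝ᵥ (A.map Complex.re).mulVec w =
      (star (fun i => (w i : ℂ)) ⬝ᵥ A.mulVec (fun i => (w i : ℂ))).re := by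
  simp [dotProduct, mulVec, Complex.re_sum, Finset.mul_sum]

/-- The entrywise real part of a positive semidefinite matrix is positive semidefinite, because
its quadratic form is that of the matrix, restricted to real vectors. -/
lemma PosSemidef.map_re {ι : Type*} [Fintype ι] {A : Matrix ι ι ℂ} (hA : A.PosSemidef) :
    (A.map Complex.re).PosSemidef := by
  refine .of_dotProduct_mulVec_nonneg ?_ fun w => ?_
  · ext i j
    have h := congrArg Complex.re (hA.1.apply i j)
    simpa using h
  · have h := hA.dotProduct_mulVec_nonneg (fun i => (w i : ℂ))
    rw [star_trivial, dotProduct_map_re_mulVec]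
    exact (Complex.le_def.1 h).1

lemma star_dotProduct_mul_diagonal_mul_conjTranspose {ι : Type*} [Fintype ι] [DecidableEq ι]
    (D : Matrix ι ι ℂ) (d : ι → ℝ) (x : ι → ℂ) :
    star x ⬝ᵥ (D * diagonal (fun i => (d i : ℂ)) * Dᴴ).mulVec x =
      ((∑ i, d i * ‖(Dᴴ.mulVec x) i‖ ^ 2 : ℝ) : ℂ) := by
  have h1 : star x ᵥ* D = star (Dᴴ *ᵥ x) := by
    rw [star_mulVec, conjTranspose_conjTranspose]
  rw [← mulVec_mulVec, ← mulVec_mulVec, dotProduct_mulVec, h1]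
  simp only [dotProduct, mulVec_diagonal, Pi.star_apply, Complex.ofReal_sum, Complex.ofReal_mul,
    Complex.ofReal_pow]
  refine Finset.sum_congr rfl fun i _ => ?_
  rw [← Complex.conj_mul', RCLike.star_def]
  ring

/-- The pulse sequence `m ↦ q(t - m δ T)` of a block, tested against the character
`m ↦ e^{2π i m c}`. -/
def blockTransform (q : ℝ → ℝ) (T δ : ℝ) (M : ℕ) (t c : ℝ) : ℂ :=
  ∑ m : Idx M, (q (t - ((m : ℤ) : ℝ) * δ * T) : ℂ) *
    Complex.exp (2 * Real.pi * Complex.I * ((m : ℤ) : ℂ) * (c : ℂ))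

/-- Mean power `E |x(t)|²` of the signal formed with the pulse `q`, in the eigenbasis of the
symbol covariance. -/
def meanPower (p q : ℝ → ℝ) (β T δ P : ℝ) (M : ℕ) (t : ℝ) : ℝ :=
  P * δ * T / blockLen M * ∑ i : Idx M, optEigenvalue p β T δ M i *
    ‖blockTransform q T δ M t (((i : ℤ) : ℝ) / blockLen M)‖ ^ 2

lemma blockLen_pos (M : ℕ) : 0 < blockLen M := by
  unfold blockLen; positivity

lemma norm_sq_dftMatrix_conjTranspose_mulVec (q : ℝ → ℝ) (T δ : ℝ) (M : ℕ) (t : ℝ) (i : Idx M) :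
    ‖((dftMatrix M)ᴴ *ᵥ (fun m : Idx M => (q (t - ((m : ℤ) : ℝ) * δ * T) : ℂ))) i‖ ^ 2 =
      ‖blockTransform q T δ M t (((i : ℤ) : ℝ) / blockLen M)‖ ^ 2 / blockLen M := by
  have h : ((dftMatrix M)ᴴ *ᵥ (fun m : Idx M => (q (t - ((m : ℤ) : ℝ) * δ * T) : ℂ))) i =
      ((1 / Real.sqrt (blockLen M) : ℝ) : ℂ) *
        blockTransform q T δ M t (((i : ℤ) : ℝ) / blockLen M) := by
    simp only [mulVec, dotProduct, conjTranspose_apply, dftMatrix, blockTransform, Finset.mul_sum]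
    refine Finset.sum_congr rfl fun m _ => ?_
    rw [RCLike.star_def, map_mul, ← Complex.exp_conj]
    have h2 : (starRingEnd ℂ) (-2 * Real.pi * Complex.I * ((m : ℤ) : ℂ) * ((i : ℤ) : ℂ) /
        (blockLen M : ℂ)) = 2 * Real.pi * Complex.I * ((m : ℤ) : ℂ) *
          (((((i : ℤ) : ℝ) / blockLen M : ℝ)) : ℂ) := by
      simp [map_ofNat]
      ring
    rw [h2]
    simp
    ring
  rw [h, norm_mul, mul_pow, Complex.norm_real, Real.norm_eq_abs, sq_abs, div_pow, one_pow,
    Real.sq_sqrt (blockLen_pos M).le]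
  ring

lemma dotProduct_optCovariance_re (p q : ℝ → ℝ) (β T δ P : ℝ) (M : ℕ) (t : ℝ) {w : Idx M → ℝ}
    (hw : w = fun m : Idx M => q (t - ((m : ℤ) : ℝ) * δ * T)) :
    w ⬝ᵥ ((optCovariance p β T δ P M).map Complex.re).mulVec w =
      meanPower p q β T δ P M t := by
  subst hw
  rw [dotProduct_map_re_mulVec, optCovariance, smul_mulVec, dotProduct_smul,
    star_dotProduct_mul_diagonal_mul_conjTranspose, smul_eq_mul, ← Complex.ofReal_mul,
    Complex.ofReal_re, meanPower]
  simp_rw [norm_sq_dftMatrix_conjTranspose_mulVec]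
  rw [div_mul_eq_mul_div, mul_div_assoc, Finset.sum_div]
  simp_rw [mul_div_assoc]

lemma optCovariance_posSemidef {p : ℝ → ℝ} {β T δ P : ℝ} {M : ℕ} (hP : 0 ≤ P * δ * T)
    (hnn : ∀ i, 0 ≤ optEigenvalue p β T δ M i) : (optCovariance p β T δ P M).PosSemidef := by
  refine PosSemidef.smul (PosSemidef.mul_mul_conjTranspose_same (.diagonal fun i => ?_) _) ?_
  · have h : (0 : ℂ) ≤ (optEigenvalue p β T δ M i : ℂ) := by exact_mod_cast hnn i
    exact h
  · exact_mod_cast hP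

/-- At every instant of positive mean power, the instantaneous power of the signal is
exponentially distributed. -/
lemma ccdf_symbolLaw {p q : ℝ → ℝ} {β T δ P : ℝ} {M : ℕ} (hP : 0 ≤ P * δ * T)
    (hnn : ∀ i, 0 ≤ optEigenvalue p β T δ M i) {γ t : ℝ} (hγ : 0 ≤ γ)
    (hpos : 0 < meanPower p q β T δ P M t) :
    ccdf (symbolLaw p β T δ P M) q T δ γ t = Real.exp (-γ / meanPower p q β T δ P M t) := by
  have hS : ((1 / 2 : ℝ) • (optCovariance p β T δ P M).map Complex.re).PosSemidef :=
    PosSemidef.smul (PosSemidef.map_re (optCovariance_posSemidef hP hnn)) (by norm_num)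
  have hv : 2 * ((fun m : Idx M => q (t - ((m : ℤ) : ℝ) * δ * T)) ⬝ᵥ
      ((1 / 2 : ℝ) • (optCovariance p β T δ P M).map Complex.re).mulVec
        (fun m : Idx M => q (t - ((m : ℤ) : ℝ) * δ * T))) = meanPower p q β T δ P M t := by
    rw [smul_mulVec, dotProduct_smul, dotProduct_optCovariance_re p q β T δ P M t rfl,
      smul_eq_mul]
    ring
  rw [symbolLaw, ccdf_prod_multivariateGaussian hS q T δ t hγ rfl (by linarith), hv]

end Covariance

/-! ### Transform of the sampled pulse by Poisson summation -/

section Poisson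

open FourierTransform

lemma integrable_of_decay {p : ℝ → ℝ} (hp : Continuous p) {r C : ℝ} (hr : 1 < r)
    (hC : ∀ t, |p t| ≤ C * (1 + |t|) ^ (-r)) : Integrable p := by
  have h : Integrable fun t : ℝ => C * (1 + ‖t‖) ^ (-r) :=
    (integrable_one_add_norm (by simpa using hr)).const_mul C
  exact h.mono' hp.aestronglyMeasurable (ae_of_all _ fun t => by simpa using hC t)

lemma fourier_star_comp_neg (f : ℝ → ℂ) (w : ℝ) :
    𝓕 (fun t => star (f (-t))) w = star (𝓕 f w) := by
  rw [Real.fourier_real_eq_integral_exp_smul, Real.fourier_real_eq_integral_exp_smul,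
    RCLike.star_def, ← integral_conj,
    ← integral_neg_eq_self (fun v : ℝ => Complex.exp (↑(-2 * Real.pi * v * w) * Complex.I) •
      (starRingEnd ℂ) (f (-v)))]
  refine integral_congr_ae (ae_of_all _ fun v => ?_)
  simp only [smul_eq_mul, neg_neg, map_mul, ← Complex.exp_conj,
    Complex.conj_ofReal, Complex.conj_I]
  congr 2
  push_cast
  ring

/-- The spectrum of the matched filter response is the energy spectrum of the pulse. -/
lemma spectrumG_eq_norm_sq {p : ℝ → ℝ} (hi : Integrable p) (f : ℝ) :
    spectrumG p f = ‖𝓕 (fun t => (p t : ℂ)) f‖ ^ 2 := by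
  have h1 : Integrable fun t => (p t : ℂ) := hi.ofReal
  have h2 : Integrable fun t => star (p (-t) : ℂ) := by
    have : Integrable fun t => (p (-t) : ℂ) := h1.comp_neg
    simpa using this
  rw [spectrumG, matchedFilter, Real.fourier_mul_convolution_eq h1 h2,
    fourier_star_comp_neg (fun t => (p t : ℂ)), RCLike.star_def, Complex.mul_conj,
    Complex.ofReal_re, Complex.normSq_eq_norm_sq]

/-- Decay of the samples `x ↦ p(t - x τ)`, uniform over bounded `t`: it serves both as the decay
assumption of Poisson summation and as a summable majorant of the tails. At `x = 0` the right-hand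
side takes the junk value `0`, hence `hx`. -/
lemma abs_comp_sub_mul_le {p : ℝ → ℝ} {r C : ℝ} (hr : 1 < r)
    (hC : ∀ t, |p t| ≤ C * (1 + |t|) ^ (-r)) {τ : ℝ} (hτ : 0 < τ) {t a x : ℝ} (ht : |t| ≤ a)
    (hx : x ≠ 0) :
    |p (t - x * τ)| ≤ C * (τ / (1 + a)) ^ (-r) * |x| ^ (-r) := by
  have hC0 : 0 ≤ C := by simpa using (abs_nonneg _).trans (hC 0)
  have ha : 0 ≤ a := (abs_nonneg t).trans ht
  have hx' : 0 < |x| := abs_pos.2 hx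
  have h1 : |x| * τ ≤ |t| + |t - x * τ| := by
    have : x * τ = t - (t - x * τ) := by ring
    rw [← abs_of_pos hτ, ← abs_mul, abs_of_pos hτ]
    calc |x * τ| = |t - (t - x * τ)| := by rw [← this]
      _ ≤ _ := abs_sub _ _
  have h2 : τ / (1 + a) * |x| ≤ 1 + |t - x * τ| := by
    rw [div_mul_eq_mul_div, div_le_iff₀ (by linarith)]
    nlinarith [abs_nonneg (t - x * τ)]
  rw [mul_assoc, ← Real.mul_rpow (by positivity) (by positivity)]
  refine (hC _).trans (mul_le_mul_of_nonneg_left ?_ hC0)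
  exact Real.rpow_le_rpow_of_nonpos (by positivity) h2 (by linarith)

/-- Scaling, reflection, translation and modulation rules of the Fourier transform, combined. -/
lemma fourier_comp_sub_mul_mul_exp (h : ℝ → ℂ) {τ : ℝ} (hτ : 0 < τ) (t c ξ : ℝ) :
    𝓕 (fun x : ℝ => h (t - x * τ) * Complex.exp (2 * Real.pi * Complex.I * x * c)) ξ =
      (τ⁻¹ : ℝ) * (Complex.exp ((2 * Real.pi * t * ((c - ξ) / τ) : ℝ) * Complex.I) *
        𝓕 h ((c - ξ) / τ)) := by
  rw [Real.fourier_real_eq_integral_exp_smul, Real.fourier_real_eq_integral_exp_smul]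
  set H : ℝ → ℂ := fun u => Complex.exp ((2 * Real.pi * (t - u) * ((c - ξ) / τ) : ℝ) * Complex.I) *
    h u with hH
  have h1 : ∀ x : ℝ, Complex.exp (↑(-2 * Real.pi * x * ξ) * Complex.I) •
      (h (t - x * τ) * Complex.exp (2 * Real.pi * Complex.I * x * c)) =
      (fun y => H (t - y)) (x * τ) := by
    intro x
    simp only [hH, smul_eq_mul]
    rw [mul_left_comm, ← Complex.exp_add, mul_comm]
    congr 2
    have : (τ : ℂ) ≠ 0 := by exact_mod_cast hτ.ne'
    push_cast
    field_simp
    ring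
  simp_rw [h1]
  rw [Measure.integral_comp_mul_right (fun y => H (t - y)) τ, integral_sub_left_eq_self H volume t,
    abs_of_pos (inv_pos.2 hτ), Complex.real_smul]
  congr 1
  rw [← integral_const_mul]
  refine integral_congr_ae (ae_of_all _ fun u => ?_)
  simp only [hH, smul_eq_mul]
  rw [← mul_assoc, ← Complex.exp_add]
  congr 2
  push_cast
  ring

/-- The transform of the samples `m ↦ q(t - m δ T)`, `m ∈ ℤ`, at the frequency `c`. -/
def lineTransform (q : ℝ → ℝ) (T δ t c : ℝ) : ℂ :=
  ∑' m : ℤ, (q (t - (m : ℝ) * δ * T) : ℂ) *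
    Complex.exp (2 * Real.pi * Complex.I * (m : ℂ) * (c : ℂ))

lemma norm_mul_exp (x : ℂ) (m : ℤ) (c : ℝ) :
    ‖x * Complex.exp (2 * Real.pi * Complex.I * (m : ℂ) * (c : ℂ))‖ = ‖x‖ := by
  have : 2 * Real.pi * Complex.I * (m : ℂ) * (c : ℂ) =
      ((2 * Real.pi * m * c : ℝ) : ℂ) * Complex.I := by
    push_cast; ring
  rw [this, norm_mul, Complex.norm_exp_ofReal_mul_I, mul_one]

lemma summable_comp_sub {p : ℝ → ℝ} {r C : ℝ} (hr : 1 < r)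
    (hC : ∀ t, |p t| ≤ C * (1 + |t|) ^ (-r)) {T δ : ℝ} (hτ : 0 < δ * T) (t : ℝ) :
    Summable fun m : ℤ => p (t - (m : ℝ) * δ * T) := by
  refine Summable.of_norm_bounded_eventually
    ((Real.summable_abs_int_rpow hr).mul_left (C * (δ * T / (1 + |t|)) ^ (-r))) ?_
  have : {(0 : ℤ)}ᶜ ∈ (cofinite : Filter ℤ) := (Set.finite_singleton _).compl_mem_cofinite
  filter_upwards [this] with m hm
  rw [mul_assoc, Real.norm_eq_abs]
  exact abs_comp_sub_mul_le hr hC hτ le_rfl (by exact_mod_cast hm)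

/-- Poisson summation: sampling faster than the Nyquist rate of a band-limited pulse leaves a
single spectral replica, so that the transform of the samples has a modulus that depends only on
the energy spectrum, not on the sampling phase `t`. -/
lemma norm_lineTransform_sq {p : ℝ → ℝ} (hp : Continuous p) {r C : ℝ} (hr : 1 < r)
    (hC : ∀ t, |p t| ≤ C * (1 + |t|) ^ (-r)) {T δ W : ℝ} (hτ : 0 < δ * T)
    (hW : ∀ f, W ≤ |f| → spectrumG p f = 0) (hδ : δ * T * W < 1 / 2) (t : ℝ) {c : ℝ}
    (hc : |c| < δ * T * W) :
    ‖lineTransform p T δ t c‖ ^ 2 = spectrumG p (c / (δ * T)) / (δ * T) ^ 2 := by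
  have hi := integrable_of_decay hp hr hC
  set τ := δ * T with hτd
  set h : ℝ → ℂ := fun t => (p t : ℂ) with hh
  set f : ℝ → ℂ := fun x : ℝ => h (t - x * τ) *
    Complex.exp (2 * Real.pi * Complex.I * x * c) with hf
  have hcont : Continuous f := by
    simp only [hf, hh]; fun_prop
  have hO : f =O[cocompact ℝ] (fun x : ℝ => |x| ^ (-r)) := by
    refine Asymptotics.IsBigO.of_bound (C * (τ / (1 + |t|)) ^ (-r)) ?_
    have h0 : {(0 : ℝ)}ᶜ ∈ cocompact ℝ := isCompact_singleton.compl_mem_cocompact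
    filter_upwards [h0] with x hx
    have h1 : 2 * Real.pi * Complex.I * x * c = ((2 * Real.pi * x * c : ℝ) : ℂ) * Complex.I := by
      push_cast; ring
    have h2 := abs_comp_sub_mul_le hr hC hτ (le_refl |t|) hx
    simp only [hf, hh]
    rw [h1, norm_mul, Complex.norm_exp_ofReal_mul_I, mul_one, Complex.norm_real, Real.norm_eq_abs,
      Real.norm_eq_abs, abs_of_nonneg (Real.rpow_nonneg (abs_nonneg x) _)]
    exact h2
  -- The replicas `n ≠ 0` lie out of band: `|c - n| ≥ 1 - |c| > 1 / 2 > τ W`.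
  have hzero : ∀ n : ℤ, n ≠ 0 → 𝓕 f n = 0 := by
    intro n hn
    have h1 : (1 : ℝ) ≤ |(n : ℝ)| := by exact_mod_cast Int.one_le_abs hn
    have h2 : W ≤ |(c - n) / τ| := by
      rw [abs_div, abs_of_pos hτ, le_div_iff₀ hτ]
      have := abs_sub_abs_le_abs_sub (n : ℝ) c
      rw [abs_sub_comm] at this
      nlinarith
    have h3 := hW _ h2
    rw [spectrumG_eq_norm_sq hi] at h3
    have h4 : 𝓕 h ((c - n) / τ) = 0 := by simpa using h3
    simp only [hf]
    rw [fourier_comp_sub_mul_mul_exp h hτ, h4]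
    simp
  have hsum : Summable fun n : ℤ => 𝓕 f n :=
    summable_of_ne_finset_zero (s := {0}) fun n hn => hzero n (by simpa using hn)
  have hP := Real.tsum_eq_tsum_fourier_of_rpow_decay_of_summable hcont hr hO hsum 0
  have hone : ∑' n : ℤ, 𝓕 f n * fourier n ((0 : ℝ) : UnitAddCircle) =
      𝓕 f ((0 : ℤ) : ℝ) * fourier 0 ((0 : ℝ) : UnitAddCircle) :=
    tsum_eq_single 0 fun n hn => by rw [hzero n hn, zero_mul]
  have hL : lineTransform p T δ t c = ∑' n : ℤ, f (0 + n) := by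
    rw [lineTransform]
    refine tsum_congr fun n => ?_
    simp [hf, hh, hτd, mul_assoc]
  have hF : 𝓕 f ((0 : ℤ) : ℝ) = (τ⁻¹ : ℝ) *
      (Complex.exp ((2 * Real.pi * t * ((c - (0 : ℤ)) / τ) : ℝ) * Complex.I) *
        𝓕 h ((c - (0 : ℤ)) / τ)) := fourier_comp_sub_mul_mul_exp h hτ t c _
  rw [hL, hP, hone, hF, spectrumG_eq_norm_sq hi]
  simp only [fourier_zero, mul_one, norm_mul, Complex.norm_exp_ofReal_mul_I, Complex.norm_real,
    Int.cast_zero, sub_zero, one_mul, Real.norm_eq_abs, abs_of_pos (inv_pos.2 hτ)]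
  rw [mul_pow, inv_pow]
  ring

end Poisson

/-! ### Truncation to a finite block -/

/-- Integral comparison for the tail of the series `∑ n^{-r}`. -/
lemma sum_rpow_neg_le {r : ℝ} (hr : 1 < r) {M : ℕ} (hM : 0 < M) (a : ℕ) :
    ∑ i ∈ Finset.range a, ((M : ℝ) + (i + 1 : ℕ)) ^ (-r) ≤ (M : ℝ) ^ (1 - r) / (r - 1) := by
  have hM' : (0 : ℝ) < M := by exact_mod_cast hM
  have hanti : AntitoneOn (fun x : ℝ => x ^ (-r)) (Set.Icc (M : ℝ) (M + a)) := by
    intro x hx y hy hxy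
    exact Real.rpow_le_rpow_of_nonpos (hM'.trans_le hx.1) hxy (by linarith)
  refine hanti.sum_le_integral.trans ?_
  rw [integral_rpow]
  · have h1 : (0 : ℝ) ≤ ((M : ℝ) + a) ^ (-r + 1) := by positivity
    have h2 : -r + 1 = 1 - r := by ring
    rw [h2] at h1 ⊢
    rw [← neg_div_neg_eq, neg_sub, neg_sub]
    gcongr
    linarith
  · right
    refine ⟨by linarith, ?_⟩
    rw [Set.uIcc_of_le (by simp)]
    exact fun h => absurd h.1 (not_le.2 hM')

/-- Only the symbols outside the block distinguish the two transforms. -/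
lemma norm_lineTransform_sub_blockTransform_le {p : ℝ → ℝ} {r C : ℝ} (hr : 1 < r)
    (hC : ∀ t, |p t| ≤ C * (1 + |t|) ^ (-r)) {T δ : ℝ} (hτ : 0 < δ * T) {t : ℝ}
    (ht : |t| ≤ δ * T) {M : ℕ} (hM : 0 < M) (c : ℝ) :
    ‖lineTransform p T δ t c - blockTransform p T δ M t c‖ ≤
      2 * (C * (δ * T / (1 + δ * T)) ^ (-r)) * ((M : ℝ) ^ (1 - r) / (r - 1)) := by
  have hC0 : 0 ≤ C := by simpa using (abs_nonneg _).trans (hC 0)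
  set K := C * (δ * T / (1 + δ * T)) ^ (-r) with hK
  have hK0 : 0 ≤ K := by positivity
  set f : ℤ → ℂ := fun m => (p (t - (m : ℝ) * δ * T) : ℂ) *
    Complex.exp (2 * Real.pi * Complex.I * (m : ℂ) * (c : ℂ)) with hf
  have hnorm : ∀ m, ‖f m‖ = |p (t - (m : ℝ) * δ * T)| := fun m => by
    rw [hf]
    simp only [norm_mul_exp, Complex.norm_real, Real.norm_eq_abs]
  have hsf : Summable f := by
    refine Summable.of_norm ?_
    simp_rw [hnorm]
    exact (summable_comp_sub hr hC hτ t).abs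
  set s := Finset.Icc (-(M : ℤ)) (M : ℤ) with hs
  have hB : blockTransform p T δ M t c = ∑ m ∈ s, f m :=
    Finset.sum_coe_sort s f
  have hdiff : lineTransform p T δ t c - blockTransform p T δ M t c =
      ∑' m : ℤ, Set.indicator (↑s : Set ℤ)ᶜ f m := by
    rw [hB, ← tsum_subtype, lineTransform, ← hsf.sum_add_tsum_compl (s := s)]
    simp
  rw [hdiff]
  set u : ℤ → ℝ := Set.indicator (↑s : Set ℤ)ᶜ (fun m => K * |(m : ℝ)| ^ (-r)) with hu
  have hle : ∀ m, ‖Set.indicator (↑s : Set ℤ)ᶜ f m‖ ≤ u m := by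
    intro m
    by_cases hm : m ∈ (↑s : Set ℤ)ᶜ
    · have hm0 : m ≠ 0 := by
        rintro rfl
        simp [hs] at hm
      rw [hu, Set.indicator_of_mem hm, Set.indicator_of_mem hm, hnorm, mul_assoc]
      exact abs_comp_sub_mul_le hr hC hτ ht (by exact_mod_cast hm0)
    · rw [hu, Set.indicator_of_notMem hm, Set.indicator_of_notMem hm, norm_zero]
  have hsu : Summable u := ((Real.summable_abs_int_rpow hr).mul_left K).indicator _
  refine (tsum_of_norm_bounded hsu.hasSum hle).trans ?_
  have hs1 : Summable fun n : ℕ => u (n : ℤ) := hsu.comp_injective Nat.cast_injective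
  have hs2 : Summable fun n : ℕ => u (-((n : ℤ) + 1)) :=
    hsu.comp_injective (fun a b hab => by simpa using hab)
  have hval : ∀ (m : ℤ) (i : ℕ), m.natAbs = M + (i + 1) →
      u m = K * ((M : ℝ) + (i + 1 : ℕ)) ^ (-r) := by
    intro m i hmi
    have hm : m ∈ (↑s : Set ℤ)ᶜ := by
      simp only [hs, Finset.coe_Icc, Set.mem_compl_iff, Set.mem_Icc]
      omega
    have : |(m : ℝ)| = (M : ℝ) + (i + 1 : ℕ) := by
      rw [← Int.cast_abs, Int.abs_eq_natAbs, hmi]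
      push_cast; ring
    rw [hu, Set.indicator_of_mem hm, this]
  have hzero : ∀ m : ℤ, m.natAbs ≤ M → u m = 0 := by
    intro m hm
    rw [hu, Set.indicator_of_notMem]
    simp only [hs, Finset.coe_Icc, Set.mem_compl_iff, Set.mem_Icc]
    omega
  have hu0 : ∀ m, 0 ≤ u m := fun m => (norm_nonneg _).trans (hle m)
  -- Each half line contributes a tail of the series `∑ n^{-r}` starting at `M + 1`.
  have hhalf : ∀ (g : ℕ → ℤ) (k : ℕ), (∀ n < k, (g n).natAbs ≤ M) →
      (∀ i, (g (i + k)).natAbs = M + (i + 1)) → Summable (fun n => u (g n)) →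
      ∑' n, u (g n) ≤ K * ((M : ℝ) ^ (1 - r) / (r - 1)) := by
    intro g k hg1 hg2 hsg
    rw [← hsg.sum_add_tsum_nat_add k,
      Finset.sum_eq_zero (fun n hn => hzero _ (hg1 n (Finset.mem_range.1 hn))), zero_add]
    refine Real.tsum_le_of_sum_range_le (fun n => hu0 _) fun n => ?_
    rw [Finset.sum_congr rfl fun i _ => hval _ i (hg2 i), ← Finset.mul_sum]
    exact mul_le_mul_of_nonneg_left (sum_rpow_neg_le hr hM n) hK0
  have hsplit := tsum_of_nat_of_neg_add_one hs1 hs2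
  rw [hsplit]
  have e1 := hhalf (fun n => (n : ℤ)) (M + 1) (fun n hn => by simp; omega)
    (fun i => by simp; omega) hs1
  have e2 := hhalf (fun n => -((n : ℤ) + 1)) M (fun n hn => by omega)
    (fun i => by push_cast; omega) hs2
  linarith

/-! ### Frequencies in the band -/

/-- The frequencies below the band edge are the `2 ⌈N b⌉ - 1` indices `|i| < N b`. -/
lemma numNonzero_add_one {p : ℝ → ℝ} {T δ b : ℝ} (hb0 : 0 < b) (hb : b < 1 / 2) {M : ℕ}
    (hG : ∀ i : ℤ, spectrumG p ((i : ℝ) / (blockLen M * δ * T)) ≠ 0 ↔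
      |(i : ℝ)| < blockLen M * b) :
    numNonzero p T δ M + 1 = 2 * ⌈blockLen M * b⌉₊ := by
  have hN := blockLen_pos M
  set c := ⌈blockLen M * b⌉₊ with hc
  have hc0 : 0 < c := Nat.ceil_pos.2 (by positivity)
  have hcM : c ≤ M + 1 := by
    rw [hc, Nat.ceil_le]
    push_cast
    have : blockLen M * b ≤ blockLen M * (1 / 2) := by gcongr
    unfold blockLen at this ⊢
    linarith
  have hG' : ∀ i : ℤ, spectrumG p ((i : ℝ) / (blockLen M * δ * T)) ≠ 0 ↔
      i ∈ Finset.Ioo (-(c : ℤ)) (c : ℤ) := by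
    intro i
    rw [hG, ← Int.cast_abs, Int.abs_eq_natAbs, Int.cast_natCast, ← Nat.lt_ceil, ← hc,
      Finset.mem_Ioo]
    omega
  have e : {i : Idx M // spectrumG p (((i : ℤ) : ℝ) / (blockLen M * δ * T)) ≠ 0} ≃
      ↥(Finset.Ioo (-(c : ℤ)) (c : ℤ)) :=
    { toFun := fun i => ⟨i.1.1, (hG' _).1 i.2⟩
      invFun := fun i => ⟨⟨i.1, by
        have := Finset.mem_Ioo.1 i.2
        rw [Finset.mem_Icc]
        omega⟩, (hG' _).2 i.2⟩
      left_inv := fun i => rfl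
      right_inv := fun i => rfl }
  rw [numNonzero, Nat.card_congr e, Nat.card_eq_fintype_card, Fintype.card_coe, Int.card_Ioo]
  omega

/-- The cutoff `|i| < Z / 2` removes exactly the indices at which the spectrum vanishes. -/
lemma optEigenvalue_eq {p : ℝ → ℝ} {β T δ b : ℝ} (hb0 : 0 < b) (hb : b < 1 / 2) {M : ℕ}
    (hG : ∀ i : ℤ, spectrumG p ((i : ℝ) / (blockLen M * δ * T)) ≠ 0 ↔
      |(i : ℝ)| < blockLen M * b) (i : Idx M) :
    optEigenvalue p β T δ M i =
      T / (spectrumG p (((i : ℤ) : ℝ) / (blockLen M * δ * T)) * (1 + β)) := by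
  have hZ := numNonzero_add_one hb0 hb hG
  have hiff : |((i : ℤ) : ℝ)| < (numNonzero p T δ M : ℝ) / 2 ↔
      |((i : ℤ) : ℝ)| < blockLen M * b := by
    rw [← Int.cast_abs, Int.abs_eq_natAbs, Int.cast_natCast,
      ← Nat.lt_ceil (a := blockLen M * b), lt_div_iff₀ (by norm_num : (0 : ℝ) < 2)]
    constructor
    · intro h
      have : (i : ℤ).natAbs * 2 < numNonzero p T δ M := by exact_mod_cast h
      omega
    · intro h
      have : (i : ℤ).natAbs * 2 < numNonzero p T δ M := by omega
      exact_mod_cast this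
  rw [optEigenvalue]
  split_ifs with h
  · rfl
  · have h0 : spectrumG p (((i : ℤ) : ℝ) / (blockLen M * δ * T)) = 0 := by
      by_contra hne
      exact h (hiff.2 ((hG _).1 hne))
    -- The division by the vanishing spectrum takes the junk value `0`, which is the eigenvalue.
    rw [h0, zero_mul, div_zero]

/-! ### Periodic repetition of the block -/

/-- Euclidean division by the block length: `m + l N ↔ (m, l)`, with remainders in `-M, …, M`. -/
def blockEquiv (M : ℕ) : Idx M × ℤ ≃ ℤ where
  toFun x := x.1 + x.2 * (2 * M + 1)
  invFun k := (⟨(k + M) % (2 * M + 1) - M, by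
    have h1 := Int.emod_nonneg (k + M) (b := 2 * (M : ℤ) + 1) (by omega)
    have h2 := Int.emod_lt_of_pos (k + M) (b := 2 * (M : ℤ) + 1) (by omega)
    rw [Finset.mem_Icc]
    omega⟩, (k + M) / (2 * M + 1))
  left_inv := by
    rintro ⟨⟨m, hm⟩, l⟩
    rw [Finset.mem_Icc] at hm
    have h0 : (2 * (M : ℤ) + 1) ≠ 0 := by omega
    have e : m + l * (2 * (M : ℤ) + 1) + M = (m + M) + l * (2 * M + 1) := by ring
    have h1 : (m + (M : ℤ)) % (2 * M + 1) = m + M := Int.emod_eq_of_lt (by omega) (by omega)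
    have h2 : (m + (M : ℤ)) / (2 * M + 1) = 0 := Int.ediv_eq_zero_of_lt (by omega) (by omega)
    simp only [e, Int.add_mul_emod_self_right, Int.add_mul_ediv_right _ _ h0, h1, h2]
    simp
  right_inv := by
    intro k
    have := Int.emod_add_ediv_mul (k + M) (2 * M + 1)
    simp only
    linarith

/-- For a frequency of the block, repeating the block periodically turns the block transform into
the transform of the whole sequence of samples. -/
lemma blockTransform_periodize {p : ℝ → ℝ} {T δ : ℝ} {M : ℕ} {t : ℝ}
    (hs : Summable fun m : ℤ => p (t - (m : ℝ) * δ * T)) (i : ℤ) :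
    blockTransform (periodize p (blockLen M * δ * T)) T δ M t ((i : ℝ) / blockLen M) =
      lineTransform p T δ t ((i : ℝ) / blockLen M) := by
  have hN := blockLen_pos M
  set c : ℝ := (i : ℝ) / blockLen M with hc
  set f : ℤ → ℂ := fun m => (p (t - (m : ℝ) * δ * T) : ℂ) *
    Complex.exp (2 * Real.pi * Complex.I * (m : ℂ) * (c : ℂ)) with hf
  have hsf : Summable f := by
    refine Summable.of_norm ?_
    simp only [hf, norm_mul_exp, Complex.norm_real]
    exact hs.norm
  have hsf' : Summable fun x => f (blockEquiv M x) := (blockEquiv M).summable_iff.2 hsf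
  have h1 : lineTransform p T δ t c = ∑ m : Idx M, ∑' l : ℤ, f (blockEquiv M (m, l)) := by
    rw [lineTransform, ← (blockEquiv M).tsum_eq, hsf'.tsum_prod, tsum_fintype]
  rw [h1, blockTransform]
  refine Finset.sum_congr rfl fun m _ => ?_
  rw [periodize, Complex.ofReal_tsum, ← tsum_mul_right]
  refine tsum_congr fun l => ?_
  have hm : ((blockEquiv M (m, l) : ℤ) : ℝ) = (m : ℤ) + l * blockLen M := by
    simp [blockEquiv, blockLen]
  simp only [hf]
  congr 1
  · rw [hm]
    congr 2
    ring
  · have hm' : ((blockEquiv M (m, l) : ℤ) : ℂ) = ((m : ℤ) : ℂ) + l * (blockLen M : ℂ) := by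
      have := congrArg (fun x : ℝ => (x : ℂ)) hm
      push_cast at this
      exact this
    have hN' : (blockLen M : ℂ) ≠ 0 := by exact_mod_cast hN.ne'
    have e : 2 * Real.pi * Complex.I * ((blockEquiv M (m, l) : ℤ) : ℂ) * (c : ℂ) =
        2 * Real.pi * Complex.I * ((m : ℤ) : ℂ) * (c : ℂ) +
          ((l * i : ℤ) : ℂ) * (2 * Real.pi * Complex.I) := by
      rw [hm', hc]
      push_cast
      field_simp
    rw [e, Complex.exp_add, Complex.exp_int_mul_two_pi_mul_I, mul_one]

/-! ### Large block limit -/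

/-- Weighted `ℓ²` triangle inequality. -/
lemma abs_sqrt_sum_sub_sqrt_sum_le {ι : Type*} [Fintype ι] {w : ι → ℝ} (hw : ∀ i, 0 ≤ w i)
    (x y : ι → ℂ) :
    |Real.sqrt (∑ i, w i * ‖x i‖ ^ 2) - Real.sqrt (∑ i, w i * ‖y i‖ ^ 2)| ≤
      Real.sqrt (∑ i, w i * ‖x i - y i‖ ^ 2) := by
  have h : ∀ z : ι → ℂ, Real.sqrt (∑ i, w i * ‖z i‖ ^ 2) =
      ‖(WithLp.toLp 2 (fun i => (Real.sqrt (w i) : ℂ) * z i) : EuclideanSpace ℂ ι)‖ := by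
    intro z
    rw [EuclideanSpace.norm_eq]
    congr 1
    refine Finset.sum_congr rfl fun i _ => ?_
    simp only [norm_mul, Complex.norm_real, Real.norm_eq_abs, mul_pow, sq_abs,
      Real.sq_sqrt (hw i)]
  rw [h, h, h (fun i => x i - y i)]
  refine (abs_norm_sub_norm_le _ _).trans (le_of_eq ?_)
  rw [← WithLp.toLp_sub]
  congr 2
  ext i
  simp [mul_sub]

lemma continuous_meanPower {p q : ℝ → ℝ} (hq : Continuous q) (β T δ P : ℝ) (M : ℕ) :
    Continuous fun t => meanPower p q β T δ P M t := by
  unfold meanPower blockTransform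
  fun_prop

lemma avgCCDF_eq_of_forall {M : ℕ}
    {μ : Measure (EuclideanSpace ℝ (Idx M) × EuclideanSpace ℝ (Idx M))} {q : ℝ → ℝ}
    {T δ γ : ℝ} (hτ : 0 < δ * T) {f : ℝ → ℝ}
    (h : ∀ t ∈ Set.Icc 0 (δ * T), ccdf μ q T δ γ t = f t) :
    avgCCDF μ q T δ γ = 1 / (δ * T) * ∫ t in (0 : ℝ)..(δ * T), f t := by
  rw [avgCCDF]
  congr 1
  refine intervalIntegral.integral_congr fun t ht => h t ?_
  rwa [Set.uIcc_of_le hτ.le] at ht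

lemma tendsto_blockLen : Tendsto blockLen atTop atTop := by
  refine tendsto_atTop_add_const_right _ _ ?_
  exact tendsto_natCast_atTop_atTop.const_mul_atTop two_pos

/-- The mean power that infinitely many samples would give. The eigenvalues invert the spectrum, so
every nonvanishing frequency contributes equally, and only their number matters. -/
lemma meanPower_line {p : ℝ → ℝ} {β T P δ : ℝ} (hβ : 0 ≤ β) (hT : 0 < T) (hδ0 : 0 < δ)
    (hδ : δ * (1 + β) / 2 < 1 / 2) {M : ℕ}
    (hG : ∀ i : ℤ, spectrumG p ((i : ℝ) / (blockLen M * δ * T)) ≠ 0 ↔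
      |(i : ℝ)| < blockLen M * (δ * (1 + β) / 2)) {F : Idx M → ℂ}
    (hF : ∀ i : Idx M, |((i : ℤ) : ℝ)| < blockLen M * (δ * (1 + β) / 2) →
      ‖F i‖ ^ 2 = spectrumG p (((i : ℤ) : ℝ) / (blockLen M * δ * T)) / (δ * T) ^ 2) :
    P * δ * T / blockLen M * ∑ i : Idx M, optEigenvalue p β T δ M i * ‖F i‖ ^ 2 =
      P / (δ * (1 + β)) * (numNonzero p T δ M / blockLen M) := by
  have hN := blockLen_pos M
  have hterm : ∀ i : Idx M, optEigenvalue p β T δ M i * ‖F i‖ ^ 2 =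
      if spectrumG p (((i : ℤ) : ℝ) / (blockLen M * δ * T)) ≠ 0 then
        T / ((1 + β) * (δ * T) ^ 2) else 0 := by
    intro i
    rw [optEigenvalue_eq (by positivity) hδ hG]
    split_ifs with h
    · rw [hF i ((hG _).1 h)]
      generalize spectrumG p (((i : ℤ) : ℝ) / (blockLen M * δ * T)) = g at h ⊢
      field_simp
    · rw [not_not] at h
      rw [h, zero_mul, div_zero, zero_mul]
  simp_rw [hterm]
  rw [← Finset.sum_filter, Finset.sum_const, nsmul_eq_mul, numNonzero, Nat.card_eq_fintype_card,
    Fintype.card_subtype]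
  field_simp

lemma tendsto_numNonzero_div {p : ℝ → ℝ} {T δ b : ℝ} (hb0 : 0 < b) (hb : b < 1 / 2)
    (hG : ∀ (M : ℕ) (i : ℤ), spectrumG p ((i : ℝ) / (blockLen M * δ * T)) ≠ 0 ↔
      |(i : ℝ)| < blockLen M * b) :
    Tendsto (fun M : ℕ => (numNonzero p T δ M : ℝ) / blockLen M) atTop (𝓝 (2 * b)) := by
  have h1 : Tendsto (fun M : ℕ => 2 * ((⌈b * blockLen M⌉₊ : ℝ) / blockLen M) -
      (blockLen M)⁻¹) atTop (𝓝 (2 * b - 0)) :=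
    (((tendsto_nat_ceil_mul_div_atTop hb0.le).comp tendsto_blockLen).const_mul 2).sub
      (tendsto_inv_atTop_zero.comp tendsto_blockLen)
  rw [sub_zero] at h1
  refine h1.congr fun M => ?_
  have h2 : (numNonzero p T δ M : ℝ) + 1 = 2 * (⌈blockLen M * b⌉₊ : ℝ) := by
    exact_mod_cast numNonzero_add_one hb0 hb (hG M)
  rw [eq_sub_of_add_eq h2, mul_comm b]
  ring

lemma rpow_one_sub_le {r : ℝ} (hr : 1 < r) {M : ℕ} (hM : 0 < M) :
    (M : ℝ) ^ (1 - r) ≤ 3 ^ (r - 1) * blockLen M ^ (1 - r) := by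
  have hM' : (1 : ℝ) ≤ M := by exact_mod_cast hM
  have h1 : blockLen M / 3 ≤ M := by unfold blockLen; linarith
  have hN := blockLen_pos M
  refine (Real.rpow_le_rpow_of_nonpos (by positivity) h1 (by linarith)).trans (le_of_eq ?_)
  rw [Real.div_rpow hN.le (by norm_num), div_eq_mul_inv, ← Real.rpow_neg (by norm_num), neg_sub,
    mul_comm]

/-- The truncation error, weighted by the eigenvalues: the tail of the pulse is `O(N^{1 - r})`, so
its energy divided by `N` is `O(N^{-(2 r - 1)})`. -/
lemma sum_truncation_le {N A ρ r : ℝ} (hN : 0 < N) (hA : 0 ≤ A) {ι : Type*}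
    [Fintype ι] {w : ι → ℝ} (hw : ∀ i, 0 ≤ w i) {R : ι → ℂ}
    (hR : ∀ i, ‖R i‖ ≤ ρ * N ^ (1 - r)) :
    ∑ i, A / N * w i * ‖R i‖ ^ 2 ≤ A * ρ ^ 2 * ((∑ i, w i) / N ^ (2 * r - 1)) := by
  have h1 : (N ^ (1 - r)) ^ 2 / N = 1 / N ^ (2 * r - 1) := by
    rw [← Real.rpow_natCast, ← Real.rpow_mul hN.le, one_div, ← Real.rpow_neg hN.le,
      ← Real.rpow_sub_one hN.ne']
    congr 1
    push_cast
    ring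
  have h2 : A * ρ ^ 2 * ((∑ i, w i) / N ^ (2 * r - 1)) =
      ∑ i, A / N * w i * (ρ * N ^ (1 - r)) ^ 2 := by
    rw [← Finset.sum_mul, ← Finset.mul_sum, mul_pow, div_eq_mul_one_div (∑ i, w i), ← h1]
    ring
  rw [h2]
  refine Finset.sum_le_sum fun i _ => ?_
  have := hw i
  exact mul_le_mul_of_nonneg_left (pow_le_pow_left₀ (norm_nonneg _) (hR i) 2) (by positivity)

/-- If the mean powers converge to `P` uniformly over a period, at the level of amplitudes, then
the averaged CCDF converges to that of the exponential law of mean `P`. -/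
lemma tendsto_avgCCDF {ι : Type*} {l : Filter ι} [l.IsCountablyGenerated] {p : ℝ → ℝ}
    {q : ι → ℝ → ℝ} {β T P δ γ : ℝ} (hP : 0 < P) (hT : 0 < T) (hδ0 : 0 < δ) (hγ : 0 ≤ γ)
    {M : ι → ℕ} (hnn : ∀ j i, 0 ≤ optEigenvalue p β T δ (M j) i)
    (hmeas : ∀ j, AEStronglyMeasurable (fun t => meanPower p (q j) β T δ P (M j) t)
      (volume.restrict (Set.uIoc 0 (δ * T))))
    {a ε : ι → ℝ} (ha : Tendsto a l (𝓝 P)) (hε : Tendsto ε l (𝓝 0))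
    (hclose : ∀ᶠ j in l, ∀ t ∈ Set.Icc 0 (δ * T),
      |Real.sqrt (meanPower p (q j) β T δ P (M j) t) - Real.sqrt (a j)| ≤ Real.sqrt (ε j)) :
    Tendsto (fun j => avgCCDF (symbolLaw p β T δ P (M j)) (q j) T δ γ) l
      (𝓝 (Real.exp (-γ / P))) := by
  have hτ : 0 < δ * T := by positivity
  have hsa : Tendsto (fun j => Real.sqrt (a j)) l (𝓝 (Real.sqrt P)) := ha.sqrt
  have hsε : Tendsto (fun j => Real.sqrt (ε j)) l (𝓝 0) := by simpa using hε.sqrt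
  have hpos : ∀ᶠ j in l, ∀ t ∈ Set.Icc 0 (δ * T), 0 < meanPower p (q j) β T δ P (M j) t := by
    have h1 : Tendsto (fun j => Real.sqrt (a j) - Real.sqrt (ε j)) l (𝓝 (Real.sqrt P)) := by
      simpa using hsa.sub hsε
    filter_upwards [h1.eventually_const_lt (Real.sqrt_pos.2 hP), hclose] with j hj hc t ht
    have := (abs_le.1 (hc t ht)).1
    exact Real.sqrt_pos.1 (by linarith)
  have hlim : ∀ t ∈ Set.Icc 0 (δ * T),
      Tendsto (fun j => meanPower p (q j) β T δ P (M j) t) l (𝓝 P) := by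
    intro t ht
    have h1 : Tendsto (fun j => Real.sqrt (meanPower p (q j) β T δ P (M j) t) - Real.sqrt (a j))
        l (𝓝 0) :=
      squeeze_zero_norm' (hclose.mono fun j hj => hj t ht) hsε
    have h2 := (h1.add hsa).pow 2
    simp only [sub_add_cancel, zero_add, Real.sq_sqrt hP.le] at h2
    exact h2.congr' (hpos.mono fun j hj => Real.sq_sqrt (hj t ht).le)
  have hconst : Real.exp (-γ / P) =
      1 / (δ * T) * ∫ _ in (0 : ℝ)..(δ * T), Real.exp (-γ / P) := by
    rw [intervalIntegral.integral_const, sub_zero, smul_eq_mul]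
    field_simp
  rw [hconst]
  have hsub : ∀ t ∈ Set.uIoc 0 (δ * T), t ∈ Set.Icc 0 (δ * T) := fun t ht => by
    rw [Set.uIoc_of_le hτ.le] at ht
    exact ⟨ht.1.le, ht.2⟩
  have hint : Tendsto (fun j => ∫ t in (0 : ℝ)..(δ * T),
      Real.exp (-γ / meanPower p (q j) β T δ P (M j) t)) l
      (𝓝 (∫ _ in (0 : ℝ)..(δ * T), Real.exp (-γ / P))) := by
    refine intervalIntegral.tendsto_integral_filter_of_dominated_convergence (fun _ => 1)
      (Eventually.of_forall fun j => ?_) (hpos.mono fun j hj => ae_of_all _ fun t ht => ?_)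
      intervalIntegrable_const (ae_of_all _ fun t ht => ?_)
    · exact ((hmeas j).aemeasurable.const_div (-γ)).exp.aestronglyMeasurable
    · rw [Real.norm_eq_abs, Real.abs_exp, Real.exp_le_one_iff, neg_div]
      have := hj t (hsub t ht)
      exact neg_nonpos.2 (by positivity)
    · exact (Real.continuous_exp.tendsto _).comp
        ((tendsto_const_nhds (x := -γ)).div (hlim t (hsub t ht)) hP.ne')
  refine (hint.const_mul _).congr' (hpos.mono fun j hj => ?_)
  exact (avgCCDF_eq_of_forall hτ fun t ht =>
    ccdf_symbolLaw (by positivity) (hnn j) hγ (hj t ht)).symm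

end FTN

end

/-- Large block limit of the period-averaged CCDF of the FTN signal, for Gaussian symbols, the
optimal covariance and fixed transmit power `P`: it is `exp (-γ / P)` for every acceleration
factor `δ < 1 / (1 + β)`, first for the cyclostationary signal, then for the signal that
consists of one finite block. -/
theorem mainTheorem1
    (β T P : ℝ) (hβ : 0 ≤ β) (hT : 0 < T) (hP : 0 < P)
    (p : ℝ → ℝ) (hp : Continuous p)
    (r : ℝ) (hr : 1 < r) (hdecay : ∃ C : ℝ, ∀ t : ℝ, |p t| ≤ C * (1 + |t|) ^ (-r))
    (hband : ∀ f : ℝ, FTN.spectrumG p f ≠ 0 ↔ |f| < (1 + β) / (2 * T))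
    (δ : ℝ) (hδ0 : 0 < δ) (hδ : δ < 1 / (1 + β))
    (γ : ℝ) (hγ : 0 ≤ γ) :
    Tendsto
        (fun M : ℕ => FTN.avgCCDF (FTN.symbolLaw p β T δ P M)
          (FTN.periodize p (FTN.blockLen M * δ * T)) T δ γ)
        atTop (𝓝 (Real.exp (-γ / P))) ∧
      ∀ M : ℕ → ℕ, Tendsto M atTop atTop →
        Tendsto
          (fun j => (∑ i : FTN.Idx (M j), FTN.optEigenvalue p β T δ (M j) i) /
            FTN.blockLen (M j) ^ (2 * r - 1))
          atTop (𝓝 0) →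
        Tendsto
          (fun j => FTN.avgCCDF (FTN.symbolLaw p β T δ P (M j)) p T δ γ)
          atTop (𝓝 (Real.exp (-γ / P))) := by
  obtain ⟨C, hC⟩ := hdecay
  have hi := FTN.integrable_of_decay hp hr hC
  have hτ : 0 < δ * T := by positivity
  have hβ1 : 0 < 1 + β := by linarith
  -- `b` is the band edge in units of the sampling rate `1 / (δ T)`.
  set b := δ * (1 + β) / 2 with hb
  have hb0 : 0 < b := by positivity
  have hb1 : b < 1 / 2 := by
    have := (lt_div_iff₀ hβ1).1 hδ
    rw [hb]
    linarith
  have hbW : δ * T * ((1 + β) / (2 * T)) = b := by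
    rw [hb]
    field_simp
  have hG : ∀ (M : ℕ) (i : ℤ), FTN.spectrumG p ((i : ℝ) / (FTN.blockLen M * δ * T)) ≠ 0 ↔
      |(i : ℝ)| < FTN.blockLen M * b := by
    intro M i
    have hN := FTN.blockLen_pos M
    have hpos : 0 < FTN.blockLen M * δ * T := by positivity
    rw [hband, abs_div, abs_of_pos hpos, div_lt_iff₀ hpos, ← hbW]
    ring_nf
  have hW : ∀ f, (1 + β) / (2 * T) ≤ |f| → FTN.spectrumG p f = 0 := fun f hf => by
    by_contra h
    exact absurd ((hband f).1 h) (not_lt.2 hf)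
  have hnn : ∀ (M : ℕ) (i : FTN.Idx M), 0 ≤ FTN.optEigenvalue p β T δ M i := by
    intro M i
    rw [FTN.optEigenvalue_eq hb0 hb1 (hG M), FTN.spectrumG_eq_norm_sq hi]
    positivity
  have hline : ∀ (M : ℕ) (t : ℝ), P * δ * T / FTN.blockLen M *
      ∑ i : FTN.Idx M, FTN.optEigenvalue p β T δ M i *
        ‖FTN.lineTransform p T δ t (((i : ℤ) : ℝ) / FTN.blockLen M)‖ ^ 2 =
      P / (δ * (1 + β)) * (FTN.numNonzero p T δ M / FTN.blockLen M) := by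
    intro M t
    have hN := FTN.blockLen_pos M
    refine FTN.meanPower_line hβ hT hδ0 hb1 (hG M) fun i hi => ?_
    rw [FTN.norm_lineTransform_sq hp hr hC hτ hW (by rw [hbW]; exact hb1), div_div, mul_assoc]
    rwa [hbW, abs_div, abs_of_pos hN, div_lt_iff₀ hN, mul_comm]
  have hlim : Tendsto (fun M => P / (δ * (1 + β)) *
      ((FTN.numNonzero p T δ M : ℝ) / FTN.blockLen M)) atTop (𝓝 P) := by
    have h := (FTN.tendsto_numNonzero_div hb0 hb1 hG).const_mul (P / (δ * (1 + β)))
    have e : P / (δ * (1 + β)) * (2 * b) = P := by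
      rw [hb]
      field_simp
    rwa [e] at h
  constructor
  · have hmean : ∀ (M : ℕ) (t : ℝ),
        FTN.meanPower p (FTN.periodize p (FTN.blockLen M * δ * T)) β T δ P M t =
        P / (δ * (1 + β)) * (FTN.numNonzero p T δ M / FTN.blockLen M) := by
      intro M t
      rw [← hline M t, FTN.meanPower]
      simp_rw [FTN.blockTransform_periodize (FTN.summable_comp_sub hr hC hτ t)]
    refine FTN.tendsto_avgCCDF hP hT hδ0 hγ hnn (fun M => ?_) hlim
      (tendsto_const_nhds (x := (0 : ℝ))) (Eventually.of_forall fun M t _ => ?_)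
    · simp_rw [hmean]
      exact aestronglyMeasurable_const
    · rw [hmean, sub_self, abs_zero]
      exact Real.sqrt_nonneg _
  · intro M hM hsum
    set ρ := 2 * (C * (δ * T / (1 + δ * T)) ^ (-r)) * (3 ^ (r - 1) / (r - 1)) with hρ
    have hε := hsum.const_mul (P * δ * T * ρ ^ 2)
    rw [mul_zero] at hε
    refine FTN.tendsto_avgCCDF hP hT hδ0 hγ (fun j => hnn (M j))
      (fun j => (FTN.continuous_meanPower hp β T δ P (M j)).aestronglyMeasurable)
      (hlim.comp hM) hε ?_
    filter_upwards [hM.eventually_gt_atTop 0] with j hj t ht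
    have hN := FTN.blockLen_pos (M j)
    have hw : ∀ i, 0 ≤ P * δ * T / FTN.blockLen (M j) * FTN.optEigenvalue p β T δ (M j) i :=
      fun i => mul_nonneg (by positivity) (hnn _ i)
    have htri := FTN.abs_sqrt_sum_sub_sqrt_sum_le hw
      (fun i => FTN.lineTransform p T δ t (((i : ℤ) : ℝ) / FTN.blockLen (M j)))
      (fun i => FTN.blockTransform p T δ (M j) t (((i : ℤ) : ℝ) / FTN.blockLen (M j)))
    rw [abs_sub_comm, Function.comp_apply, ← hline (M j) t, FTN.meanPower, Finset.mul_sum,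
      Finset.mul_sum]
    simp_rw [← mul_assoc (P * δ * T / FTN.blockLen (M j))]
    refine htri.trans (Real.sqrt_le_sqrt (FTN.sum_truncation_le hN (by positivity) (hnn (M j))
      fun i => ?_))
    have ht' : |t| ≤ δ * T := by rw [abs_of_nonneg ht.1]; exact ht.2
    refine (FTN.norm_lineTransform_sub_blockTransform_le hr hC hτ ht' hj _).trans ?_
    have hC0 : 0 ≤ C := by simpa using (abs_nonneg _).trans (hC 0)
    have hr0 : 0 < r - 1 := by linarith
    calc 2 * (C * (δ * T / (1 + δ * T)) ^ (-r)) * ((M j : ℝ) ^ (1 - r) / (r - 1))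
        ≤ 2 * (C * (δ * T / (1 + δ * T)) ^ (-r)) *
          (3 ^ (r - 1) * FTN.blockLen (M j) ^ (1 - r) / (r - 1)) := by
          gcongr
          exact FTN.rpow_one_sub_le hr hj
      _ = ρ * FTN.blockLen (M j) ^ (1 - r) := by
          rw [hρ]
          ring
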